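/- Let $K$ be a field of characteristic $0$; all algebras are unital associative $K$-algebras. For an algebra $R$ let $T(R)\subset K\langle x_1,x_2,\ldots\rangle$ be the ideal of its polynomial identities in the free associative algebra, and let $$F_d(R)=K\langle x_1,\ldots,x_d\rangle/(K\langle x_1,\ldots,x_d\rangle\cap T(R))$$ be the relatively free algebra of rank $d$, with the multigrading in which $x_i$ has degree equal to the $i$-th standard basis vector of $\mathbb Z^d$. Its Hilbert series is $$H(F_d(R))=\sum_{n_1,\ldots,n_d\ge 0}\dim_K\bigl(F_d^{(n_1,\ldots,n_d)}(R)\bigr)\,t_1^{n_1}\cdots t_d^{n_d}\in\mathbb Z[[t_1,\ldots,t_d]],$$ where $F_d^{(n_1,\ldots,n_d)}(R)$ is the homogeneous component of degree $(n_1,\ldots,n_d)$. Likewise let $H(K[X_d])$ be the Hilbert series of the polynomial algebra $K[X_d]=K[x_1,\ldots,x_d]$ with respect to its multigrading. Let $p,q\ge 0$, and let $R_{p,q}$ be the algebra of upper block triangular $(p+2q)\times(p+2q)$ matrices over $K$ whose $p+q$ diagonal blocks, in some arbitrary fixed order, are $p$ blocks of size $1\times1$ and $q$ blocks of size $2\times2$.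 Let $M_2(K)$ be the algebra of $2\times 2$ matrices over $K$. Then for every $d\ge 0$ $$H(F_d(R_{p,q}))=\sum_{i=1}^{p}\binom{p}{i}(t_1+\cdots+t_d-1)^{i-1}H(K[X_d])^i+\sum_{j=1}^{q}\binom{q}{j}(t_1+\cdots+t_d-1)^{j-1}H(F_d(M_2(K)))^j$$ $$+\sum_{i=1}^{p}\sum_{j=1}^{q}\binom{p}{i}\binom{q}{j}(t_1+\cdots+t_d-1)^{i+j-1}H(K[X_d])^iH(F_d(M_2(K)))^j ,$$ where $H(K[X_d])=\prod_{i=1}^{d}\frac{1}{1-t_i}$. -/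

import Mathlib

noncomputable section

namespace PIAlg

universe u v

/-- The T-ideal `T(R)` in the free unital associative algebra `K⟨x₀, x₁, …⟩` of countable rank: all
`f` that vanish under every substitution of elements of `R` for the variables, a substitution being
the same thing as a homomorphism of unital `K`-algebras `K⟨x₀, x₁, …⟩ → R`. -/
def tIdeal (K : Type u) [Field K] (R : Type v) [Ring R] [Algebra K R] :
    Ideal (FreeAlgebra K ℕ) where
  carrier := {f | ∀ φ : FreeAlgebra K ℕ →ₐ[K] R, φ f = 0}
  add_mem' := fun ha hb φ => by rw [map_add, ha φ, hb φ, add_zero]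
  zero_mem' := fun φ => map_zero φ
  smul_mem' := fun c f hf φ => by rw [smul_eq_mul, map_mul, hf φ, mul_zero]

theorem mem_tIdeal {K : Type u} [Field K] {R : Type v} [Ring R] [Algebra K R]
    {f : FreeAlgebra K ℕ} :
    f ∈ tIdeal K R ↔ ∀ φ : FreeAlgebra K ℕ →ₐ[K] R, φ f = 0 := Iff.rfl

instance (K : Type u) [Field K] (R : Type v) [Ring R] [Algebra K R] :
    (tIdeal K R).IsTwoSided where
  mul_mem_of_left := fun b hf φ => by rw [map_mul, hf φ, zero_mul]

/-- The embedding `K⟨x₀, …, x_{d-1}⟩ → K⟨x₀, x₁, …⟩` of the free algebra of rank `d`. -/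
def freeIncl (K : Type u) [Field K] (d : ℕ) : FreeAlgebra K (Fin d) →ₐ[K] FreeAlgebra K ℕ :=
  FreeAlgebra.lift K fun i => FreeAlgebra.ι K (i : ℕ)

/-- The ideal `K⟨X_d⟩ ∩ T(R)` of the free algebra `K⟨X_d⟩` of rank `d`. -/
def tIdealIn (K : Type u) [Field K] (R : Type v) [Ring R] [Algebra K R] (d : ℕ) :
    Ideal (FreeAlgebra K (Fin d)) :=
  (tIdeal K R).comap (freeIncl K d)

instance (K : Type u) [Field K] (R : Type v) [Ring R] [Algebra K R] (d : ℕ) :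
    (tIdealIn K R d).IsTwoSided where
  mul_mem_of_left := fun {a} b ha => by
    change freeIncl K d (a * b) ∈ tIdeal K R
    rw [map_mul]
    exact (tIdeal K R).mul_mem_right _ ha

/-- The elements of `K⟨X_d⟩ ∩ T(R)` are the polynomial identities of `R` in `d` variables. -/
theorem mem_tIdealIn {K : Type u} [Field K] {R : Type v} [Ring R] [Algebra K R] {d : ℕ}
    {f : FreeAlgebra K (Fin d)} :
    f ∈ tIdealIn K R d ↔ ∀ r : Fin d → R, FreeAlgebra.lift K r f = 0 := by
  change freeIncl K d f ∈ tIdeal K R ↔ _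
  rw [mem_tIdeal]
  constructor
  · intro h r
    have e : (FreeAlgebra.lift K fun n : ℕ => if hn : n < d then r ⟨n, hn⟩ else 0).comp
        (freeIncl K d) = FreeAlgebra.lift K r := by
      ext i
      simp [freeIncl]
    rw [← e]
    exact h _
  · intro h φ
    have e : φ.comp (freeIncl K d) =
        FreeAlgebra.lift K fun i : Fin d => φ (FreeAlgebra.ι K (i : ℕ)) := by
      ext i
      simp [freeIncl]
    have := h fun i : Fin d => φ (FreeAlgebra.ι K (i : ℕ))
    rw [← e] at this
    exact this

/-- The relatively free algebra `F_d(R) = K⟨X_d⟩ / (K⟨X_d⟩ ∩ T(R))`. -/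
abbrev RelFree (K : Type u) [Field K] (R : Type v) [Ring R] [Algebra K R] (d : ℕ) : Type u :=
  FreeAlgebra K (Fin d) ⧸ tIdealIn K R d

/-- The homogeneous component of multidegree `n` of `K⟨X_d⟩`: the span of the words that contain
each variable `x_i` exactly `n i` times. -/
def freeComponent (K : Type u) [Field K] (d : ℕ) (n : Fin d →₀ ℕ) :
    Submodule K (FreeAlgebra K (Fin d)) :=
  Submodule.span K
    ((fun w : List (Fin d) => (w.map (FreeAlgebra.ι K)).prod) '' {w | ∀ i, w.count i = n i})

/-- The homogeneous component `F_d^{(n)}(R)` of multidegree `n` of `F_d(R)`. -/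
def relFreeComponent (K : Type u) [Field K] (R : Type v) [Ring R] [Algebra K R] (d : ℕ)
    (n : Fin d →₀ ℕ) : Submodule K (RelFree K R d) :=
  (freeComponent K d n).map (Ideal.Quotient.mkₐ K (tIdealIn K R d)).toLinearMap

/-- The components are finite dimensional, so that `Module.finrank` is their true dimension. -/
instance (K : Type u) [Field K] (R : Type v) [Ring R] [Algebra K R] (d : ℕ) (n : Fin d →₀ ℕ) :
    Module.Finite K (relFreeComponent K R d n) := by
  have hfin : {w : List (Fin d) | ∀ i, w.count i = n i}.Finite := by
    refine (List.finite_length_eq (Fin d) (∑ i, n i)).subset fun w hw => ?_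
    have h := Multiset.sum_count_eq_card (s := Finset.univ) (m := (w : Multiset (Fin d)))
      (fun a _ => Finset.mem_univ a)
    simp only [Multiset.coe_count, Multiset.coe_card] at h
    change w.length = _
    rw [← h]
    exact Finset.sum_congr rfl fun i _ => hw i
  have : Module.Finite K (freeComponent K d n) :=
    FiniteDimensional.span_of_finite K (hfin.image _)
  unfold relFreeComponent
  infer_instance

/-- The homogeneous component of multidegree `n` of the polynomial algebra `K[X_d]`: the line
spanned by the monomial `x^n`. -/
def polyComponent (K : Type u) [Field K] (d : ℕ) (n : Fin d →₀ ℕ) :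
    Submodule K (MvPolynomial (Fin d) K) :=
  Submodule.span K {MvPolynomial.monomial n 1}

/-- The Hilbert series `∑ₙ dim(A⁽ⁿ⁾) tⁿ` of a family of homogeneous components `A⁽ⁿ⁾` indexed by
multidegrees `n ∈ ℕ^d`, as a formal power series in `t_0, …, t_{d-1}` over `ℤ`. -/
def hilbertSeries (K : Type u) [Field K] {A : Type v} [AddCommGroup A] [Module K A] {d : ℕ}
    (component : (Fin d →₀ ℕ) → Submodule K A) : MvPowerSeries (Fin d) ℤ :=
  fun n => (Module.finrank K (component n) : ℤ)

/-- `H(F_d(R))`. -/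
def relFreeHilbert (K : Type u) [Field K] (R : Type v) [Ring R] [Algebra K R] (d : ℕ) :
    MvPowerSeries (Fin d) ℤ :=
  hilbertSeries K (relFreeComponent K R d)

/-- `H(K[X_d])`. -/
def polyHilbert (K : Type u) [Field K] (d : ℕ) : MvPowerSeries (Fin d) ℤ :=
  hilbertSeries K (polyComponent K d)

/-- The algebra `U(s_0, …, s_{m-1})` of upper block triangular matrices over `K` with diagonal
blocks of sizes `s_0, …, s_{m-1}`, in this order. Rows and columns are indexed by pairs
(block, position in the block); an entry vanishes when its column block precedes its row block. -/
abbrev UpperBlock (K : Type u) [Field K] {m : ℕ} (s : Fin m → ℕ) : Type u :=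
  Matrix.blockTriangularSubalgebra K K (Sigma.fst : (Σ i : Fin m, Fin (s i)) → Fin m)

end PIAlg

end

open PIAlg

/-!
Write `D = t₁ + ⋯ + t_d - 1`. The formula says that `1 + D · H(F_d(R))` is multiplicative in the
diagonal blocks of `R`, for block triangular `R`: one has
`1 + D · H(F_d(R)) = ∏ (1 + D · H(F_d(Mₛ(K))))`, the product over the diagonal blocks of sizes `s`,
and expanding the two powers on the right and cancelling `D` gives the closed form
(`relFreeHilbert_upperBlock`, `eq_sum_choose_of_one_add_mul`). By induction on the number of blocks
it is enough to split off the first block `A`, the remaining blocks forming the algebra `C`.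

The main tool is that a left ideal `J` of the free algebra is a free left module. A maximal
suffix-closed set `B` of words independent modulo `J` is a basis of the quotient by `J`
(`exists_schreierTransversal`). The words `s ∉ B` all of whose proper suffixes lie in `B`, the
frontier of `B`, give the generators `s - nf s` of `J`, where `nf` is the normal form with respect
to `B`. The coordinate of `f` at `s = x v` is a Fox derivative: sum, over all factorizations `u x w`
of the words of `f`, the word `u` times the coefficient of `v` in `nf w`. On `J` this map is linear
over the free algebra, and it is dual to the generators (`coord_mul`, `coord_gen`).

Two facts follow for `J = T(C)`.

* A polynomial vanishes on all block triangular matrices with diagonal blocks from `A` and `C` if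
  and only if it lies in `T(C)` and all its coordinates lie in `T(A)`
  (`lift_fromBlocks_eq_zero_iff`); this describes the product `T(A) T(C)`. Indeed, the entries of
  the off-diagonal block, for an off-diagonal part of the arguments that is a matrix unit in the
  single variable `x`, are sums of `u(a)_{p q} w(c)_{r r'}` over the factorizations `u x w`. As `c`
  varies independently of `a`, they vanish only if `∑ u(a)_{p q} w` is an identity of `C`, that is,
  has normal form zero, which says that the coordinates of `f` vanish at `a`.
* A homogeneous basis modulo `T(A) T(C)` consists of `B` together with the products of the words in
  a transversal of `T(A)` with the generators of `T(C)`. Since the words in `B` and in its frontier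
  are the empty word and the words `x w` with `w ∈ B`, the frontier has generating series
  `1 + D · H(F_d(C))`. Counting gives the multiplicativity (`relFreeHilbert_of_coord`).

Multihomogeneity of T-ideals, which turns dimensions of components into numbers of basis elements,
holds because `K` is infinite (`isMultihomogeneous_tIdealIn`).
-/

noncomputable section

namespace PIAlg

open Module

/-! ### Words in the free algebra -/

section Words

variable {K : Type*} [Field K] {X : Type*}

/-- The word `w = x₁ ⋯ xₖ`, as an element of the free algebra. -/
def word (K : Type*) [Field K] {X : Type*} (w : List X) : FreeAlgebra K X :=
  (w.map (FreeAlgebra.ι K)).prod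

@[simp] theorem word_nil : word K ([] : List X) = 1 := rfl

@[simp] theorem word_cons (x : X) (w : List X) :
    word K (x :: w) = FreeAlgebra.ι K x * word K w := by
  simp [word]

theorem word_append (u v : List X) : word K (u ++ v) = word K u * word K v := by
  simp [word]

/-- The words form a `K`-basis of the free algebra. -/
def wordBasis (K : Type*) [Field K] (X : Type*) : Basis (List X) K (FreeAlgebra K X) :=
  FreeAlgebra.basisFreeMonoid K X

@[simp] theorem wordBasis_apply (w : List X) : wordBasis K X w = word K w := by
  change FreeAlgebra.equivMonoidAlgebraFreeMonoid.symm
    (MonoidAlgebra.single (FreeMonoid.ofList w) (1 : K)) = _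
  change MonoidAlgebra.lift K (FreeAlgebra K X) (FreeMonoid X) (FreeMonoid.lift (FreeAlgebra.ι K))
    (MonoidAlgebra.single (FreeMonoid.ofList w) (1 : K)) = _
  rw [MonoidAlgebra.lift_single, one_smul, FreeMonoid.lift_apply]
  rfl

/-- The linear map on the free algebra with prescribed values on the words. -/
def wordLift {M : Type*} [AddCommGroup M] [Module K M] (g : List X → M) :
    FreeAlgebra K X →ₗ[K] M :=
  (wordBasis K X).constr K g

@[simp] theorem wordLift_word {M : Type*} [AddCommGroup M] [Module K M] (g : List X → M)
    (w : List X) : wordLift g (word K w) = g w := by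
  rw [← wordBasis_apply, wordLift, Basis.constr_basis]

/-- The coefficient of the word `w`. -/
def wordCoeff (w : List X) : FreeAlgebra K X →ₗ[K] K := (wordBasis K X).coord w

theorem wordCoeff_word [DecidableEq (List X)] (v w : List X) :
    wordCoeff v (word K w) = if w = v then 1 else 0 := by
  rw [wordCoeff, ← wordBasis_apply, Basis.coord_apply, Basis.repr_self, Finsupp.single_apply]

theorem wordLinearMap_ext {M : Type*} [AddCommGroup M] [Module K M]
    {g h : FreeAlgebra K X →ₗ[K] M} (H : ∀ w, g (word K w) = h (word K w)) : g = h :=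
  (wordBasis K X).ext fun w => by simpa using H w

theorem mem_of_word_mem (p : Submodule K (FreeAlgebra K X)) (H : ∀ w, word K w ∈ p)
    (f : FreeAlgebra K X) : f ∈ p := by
  have : p.mkQ = 0 := wordLinearMap_ext fun w => by simpa using H w
  simpa using LinearMap.congr_fun this f

end Words

/-! ### Schreier transversals of left ideals -/

section Schreier

variable {K : Type*} [Field K] {X : Type*}

/-- A Schreier transversal of a left ideal `J` of the free algebra: a set of words, closed under
suffixes, whose classes form a `K`-basis of the quotient by `J`. It is encoded by the set of words
together with the `K`-linear map that sends an element to the combination of words in the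
transversal to which it is congruent modulo `J`. -/
structure SchreierTransversal (J : Ideal (FreeAlgebra K X)) where
  /-- the words in the transversal -/
  words : Set (List X)
  suffix_mem : ∀ x w, x :: w ∈ words → w ∈ words
  /-- the normal form modulo `J` -/
  nf : FreeAlgebra K X →ₗ[K] FreeAlgebra K X
  sub_nf_mem : ∀ f, f - nf f ∈ J
  nf_eq_zero : ∀ f ∈ J, nf f = 0
  nf_word : ∀ w ∈ words, nf (word K w) = word K w
  nf_mem : ∀ f, nf f ∈ Submodule.span K (word K '' words)

/-- A maximal suffix-closed set of words that is linearly independent modulo `J` is a Schreier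
transversal: by maximality, its span plus `J` is stable under left multiplication by the
variables. -/
theorem exists_schreierTransversal (J : Ideal (FreeAlgebra K X)) :
    Nonempty (SchreierTransversal J) := by
  classical
  set J' : Submodule K (FreeAlgebra K X) := J.restrictScalars K with hJ'
  set e : List X → FreeAlgebra K X ⧸ J' := fun w => J'.mkQ (word K w) with he
  obtain ⟨B, hB⟩ := zorn_subset
    {B : Set (List X) | (∀ x w, x :: w ∈ B → w ∈ B) ∧ LinearIndepOn K e B} (by
      intro c hc hchain
      refine ⟨⋃₀ c, ⟨?_, ?_⟩, fun s hs => Set.subset_sUnion_of_mem hs⟩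
      · rintro x w ⟨s, hs, hw⟩
        exact ⟨s, hs, (hc hs).1 x w hw⟩
      · exact linearIndepOn_sUnion_of_directed hchain.directedOn fun s hs => (hc hs).2)
  obtain ⟨hsuf, hind⟩ := hB.prop
  have hdep : ∀ w, (∀ x v, w = x :: v → v ∈ B) → e w ∈ Submodule.span K (e '' B) := by
    intro w hw
    by_contra hcon
    have hmem : w ∈ B := by
      refine hB.le_of_ge (y := insert w B) ⟨?_, hind.insert hcon⟩ (Set.subset_insert _ _)
        (Set.mem_insert _ _)
      rintro x v (h | h)
      · exact Or.inr (hw x v h.symm)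
      · exact Or.inr (hsuf x v h)
    exact hcon (Submodule.subset_span ⟨w, hmem, rfl⟩)
  have hspan : ∀ w, e w ∈ Submodule.span K (e '' B) := by
    intro w
    induction w with
    | nil => exact hdep [] (by simp)
    | cons x w ih =>
      -- left multiplication by `x` on the quotient by the left ideal `J`
      let T : (FreeAlgebra K X ⧸ J') →ₗ[K] (FreeAlgebra K X ⧸ J') :=
        J'.mapQ J' (LinearMap.mulLeft K (FreeAlgebra.ι K x)) fun f hf => J.mul_mem_left _ hf
      have hT : ∀ v, T (e v) = e (x :: v) := fun v => by
        change J'.mkQ (FreeAlgebra.ι K x * word K v) = J'.mkQ (word K (x :: v))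
        rw [word_cons]
      rw [← hT]
      have : Submodule.span K (e '' B) ≤ (Submodule.span K (e '' B)).comap T := by
        rw [Submodule.span_le]
        rintro _ ⟨v, hv, rfl⟩
        rw [SetLike.mem_coe, Submodule.mem_comap, hT]
        refine hdep _ ?_
        rintro _ _ ⟨⟩
        exact hv
      exact this ih
  have htop : ⊤ ≤ Submodule.span K (Set.range fun w : B => e w) := by
    have hr : (Set.range fun w : B => e w) = e '' B := by
      rw [Set.image_eq_range]
    rw [hr]
    rintro q -
    obtain ⟨f, rfl⟩ := J'.mkQ_surjective q
    exact mem_of_word_mem ((Submodule.span K (e '' B)).comap J'.mkQ) hspan f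
  let b : Basis B K (FreeAlgebra K X ⧸ J') := Basis.mk hind htop
  have hb : ∀ w : B, b w = e w := fun w => Basis.mk_apply hind htop w
  let N : (FreeAlgebra K X ⧸ J') →ₗ[K] FreeAlgebra K X := b.constr K fun w : B => word K w.1
  have hN : ∀ w : B, N (e w) = word K w.1 := fun w => by
    rw [← hb, Basis.constr_basis]
  have hid : J'.mkQ ∘ₗ N = LinearMap.id := b.ext fun w => by
    rw [LinearMap.comp_apply, hb, hN]; rfl
  refine ⟨⟨B, hsuf, N ∘ₗ J'.mkQ, fun f => ?_, fun f hf => ?_, fun w hw => hN ⟨w, hw⟩,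
    fun f => ?_⟩⟩
  · have h := LinearMap.congr_fun hid (J'.mkQ f)
    have : J'.mkQ (f - N (J'.mkQ f)) = 0 := by
      rw [map_sub, sub_eq_zero]; exact h.symm
    rw [Submodule.mkQ_apply, Submodule.Quotient.mk_eq_zero] at this
    exact this
  · have : J'.mkQ f = 0 := by
      rw [Submodule.mkQ_apply, Submodule.Quotient.mk_eq_zero]; exact hf
    rw [LinearMap.comp_apply, this, map_zero]
  · have h : LinearMap.range N = Submodule.span K (word K '' B) := by
      rw [Basis.constr_range, Set.image_eq_range]
    rw [← h]
    exact ⟨_, rfl⟩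

namespace SchreierTransversal

variable {J : Ideal (FreeAlgebra K X)} (σ : SchreierTransversal J)

/-- The words that are minimal for the suffix order among those outside the transversal. -/
def frontier : Set (List X) := {s | s ∉ σ.words ∧ ∀ x w, s = x :: w → w ∈ σ.words}

/-- The generator `s - nf s` of `J` attached to a word `s` in the frontier. -/
def gen (s : List X) : FreeAlgebra K X := word K s - σ.nf (word K s)

theorem gen_mem (s : List X) : σ.gen s ∈ J := σ.sub_nf_mem _

theorem nf_of_mem_span {f : FreeAlgebra K X}
    (hf : f ∈ Submodule.span K (word K '' σ.words)) : σ.nf f = f := by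
  have : Submodule.span K (word K '' σ.words) ≤ LinearMap.eqLocus σ.nf LinearMap.id := by
    rw [Submodule.span_le]
    rintro _ ⟨w, hw, rfl⟩
    exact σ.nf_word w hw
  exact this hf

theorem words_eq_empty (h : [] ∉ σ.words) : σ.words = ∅ := by
  rw [Set.eq_empty_iff_forall_notMem]
  intro w
  induction w with
  | nil => exact h
  | cons x w ih => exact fun hw => ih (σ.suffix_mem x w hw)

theorem cons_mem_or (x : X) {w : List X} (hw : w ∈ σ.words) :
    x :: w ∈ σ.words ∨ x :: w ∈ σ.frontier := by
  by_cases h : x :: w ∈ σ.words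
  · exact Or.inl h
  · refine Or.inr ⟨h, ?_⟩
    rintro _ _ ⟨⟩
    exact hw

theorem nil_mem_or : [] ∈ σ.words ∨ [] ∈ σ.frontier := by
  by_cases h : [] ∈ σ.words
  · exact Or.inl h
  · exact Or.inr ⟨h, by simp⟩

/-- The span of the transversal and the left ideal generated by the `gen s` together exhaust the
free algebra, because this sum is stable under left multiplication by the variables. -/
theorem exists_sub_mem_span_gen (f : FreeAlgebra K X) :
    ∃ l ∈ Submodule.span K (word K '' σ.words),
      f - l ∈ Ideal.span (Set.range fun s : σ.frontier => σ.gen s) := by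
  set G := Ideal.span (Set.range fun s : σ.frontier => σ.gen s) with hG
  set W := Submodule.span K (word K '' σ.words) with hW
  suffices h : f ∈ W ⊔ G.restrictScalars K by
    obtain ⟨l, hl, g, hg, rfl⟩ := Submodule.mem_sup.1 h
    exact ⟨l, hl, by simpa using hg⟩
  have key : ∀ w, w ∈ σ.words ∨ w ∈ σ.frontier → word K w ∈ W ⊔ G.restrictScalars K := by
    rintro w (hw | hw)
    · exact Submodule.mem_sup_left (Submodule.subset_span ⟨w, hw, rfl⟩)
    · have h1 : σ.gen w ∈ G := Ideal.subset_span ⟨⟨w, hw⟩, rfl⟩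
      have h2 : word K w = σ.nf (word K w) + σ.gen w := by rw [gen]; abel
      rw [h2]
      exact Submodule.add_mem_sup (σ.nf_mem _) h1
  refine mem_of_word_mem _ (fun w => ?_) f
  induction w with
  | nil => exact key _ σ.nil_mem_or
  | cons x w ih =>
    rw [word_cons]
    have hle : W ⊔ G.restrictScalars K ≤
        (W ⊔ G.restrictScalars K).comap (LinearMap.mulLeft K (FreeAlgebra.ι K x)) := by
      refine sup_le ?_ fun g hg => Submodule.mem_sup_right (G.mul_mem_left _ hg)
      rw [hW, Submodule.span_le]
      rintro _ ⟨v, hv, rfl⟩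
      have := key _ (σ.cons_mem_or x hv)
      rwa [word_cons] at this
    exact hle ih

theorem mem_span_gen {f : FreeAlgebra K X} (hf : f ∈ J) :
    f ∈ Ideal.span (Set.range fun s : σ.frontier => σ.gen s) := by
  obtain ⟨l, hl, hg⟩ := σ.exists_sub_mem_span_gen f
  have hle : Ideal.span (Set.range fun s : σ.frontier => σ.gen s) ≤ J := by
    rw [Ideal.span_le]
    rintro _ ⟨s, rfl⟩
    exact σ.gen_mem _
  have h0 : σ.nf (f - l) = 0 := σ.nf_eq_zero _ (hle hg)
  rw [map_sub, σ.nf_eq_zero f hf, σ.nf_of_mem_span hl, zero_sub, neg_eq_zero] at h0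
  rwa [h0, sub_zero] at hg

end SchreierTransversal

end Schreier

/-! ### Fox derivatives and the free generators of a left ideal -/

section Fox

variable {K : Type*} [Field K] {X : Type*} [DecidableEq X]

/-- The value on a word `w` of the Fox derivative with respect to `x`: the sum of `φ(v) u` over all
factorizations `w = u x v`. -/
def foxWord (φ : FreeAlgebra K X →ₗ[K] K) (x : X) : List X → FreeAlgebra K X
  | [] => 0
  | y :: w => FreeAlgebra.ι K y * foxWord φ x w +
      if x = y then algebraMap K _ (φ (word K w)) else 0

/-- The Fox derivative with respect to `x`, with the right-hand factors evaluated by a linear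
functional `φ`: the linear map that sends a word `w` to the sum of `φ(v) u` over all factorizations
`w = u x v`. -/
def fox (φ : FreeAlgebra K X →ₗ[K] K) (x : X) : FreeAlgebra K X →ₗ[K] FreeAlgebra K X :=
  wordLift (foxWord φ x)

variable (φ : FreeAlgebra K X →ₗ[K] K) (x : X)

@[simp] theorem fox_one : fox φ x 1 = 0 := by
  rw [← word_nil, fox, wordLift_word, foxWord]

theorem fox_word_cons (y : X) (w : List X) : fox φ x (word K (y :: w)) =
    FreeAlgebra.ι K y * fox φ x (word K w) +
      if x = y then algebraMap K _ (φ (word K w)) else 0 := by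
  rw [fox, wordLift_word, wordLift_word, foxWord]

theorem fox_ι_mul (y : X) (f : FreeAlgebra K X) : fox φ x (FreeAlgebra.ι K y * f) =
    FreeAlgebra.ι K y * fox φ x f + if x = y then algebraMap K _ (φ f) else 0 := by
  have h : fox φ x ∘ₗ LinearMap.mulLeft K (FreeAlgebra.ι K y) =
      LinearMap.mulLeft K (FreeAlgebra.ι K y) ∘ₗ fox φ x +
        if x = y then Algebra.linearMap K _ ∘ₗ φ else 0 := by
    refine wordLinearMap_ext fun w => ?_
    have := fox_word_cons φ x y w
    rw [word_cons] at this
    split_ifs at this ⊢ <;> simpa using this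
  have := LinearMap.congr_fun h f
  split_ifs at this ⊢ <;> simpa using this

/-- On a left ideal killed by `φ` the Fox derivative is linear over the free algebra. -/
theorem fox_mul_of_mem {J : Ideal (FreeAlgebra K X)} (hφ : ∀ f ∈ J, φ f = 0)
    (g : FreeAlgebra K X) {f : FreeAlgebra K X} (hf : f ∈ J) :
    fox φ x (g * f) = g * fox φ x f := by
  induction g generalizing f with
  | grade0 r => rw [← Algebra.smul_def, map_smul, Algebra.smul_def]
  | grade1 y => simp [fox_ι_mul, hφ f hf]
  | mul a b ha hb => rw [mul_assoc, ha (J.mul_mem_left _ hf), hb hf, mul_assoc]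
  | add a b ha hb => rw [add_mul, map_add, ha hf, hb hf, add_mul]

end Fox

namespace SchreierTransversal

variable {K : Type*} [Field K] {X : Type*} [DecidableEq X]
  {J : Ideal (FreeAlgebra K X)} (σ : SchreierTransversal J)

/-- The coordinate at `s` of the elements of `J` with respect to the generators `gen s`. For a word
`s = x v` it is the Fox derivative with respect to `x` whose right-hand factors are evaluated by the
coefficient of `v` in the normal form. The empty word lies in the frontier only when `J` is the
whole algebra, with `1` as its single generator. -/
def coord : List X → FreeAlgebra K X →ₗ[K] FreeAlgebra K X
  | [] => LinearMap.id
  | x :: v => fox (wordCoeff v ∘ₗ σ.nf) x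

theorem coord_mul (s : List X) (g : FreeAlgebra K X) {f : FreeAlgebra K X} (hf : f ∈ J) :
    σ.coord s (g * f) = g * σ.coord s f := by
  cases s with
  | nil => rfl
  | cons x v =>
    exact fox_mul_of_mem _ x (fun f hf => by simp [σ.nf_eq_zero f hf]) g hf

theorem coord_word {s : List X} (hs : s ∈ σ.frontier) {w : List X} (hw : w ∈ σ.words) :
    σ.coord s (word K w) = 0 := by
  cases s with
  | nil =>
    rw [σ.words_eq_empty hs.1] at hw
    exact hw.elim
  | cons x v =>
    change fox (wordCoeff v ∘ₗ σ.nf) x (word K w) = 0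
    induction w with
    | nil => exact fox_one _ _
    | cons y w ih =>
      have hw' := σ.suffix_mem y w hw
      rw [fox_word_cons, ih hw', mul_zero, zero_add]
      split_ifs with hxy
      · rw [LinearMap.comp_apply, σ.nf_word w hw', wordCoeff_word, if_neg, map_zero]
        rintro rfl
        exact hs.1 (hxy ▸ hw)
      · rfl

theorem coord_of_mem_span {s : List X} (hs : s ∈ σ.frontier) {f : FreeAlgebra K X}
    (hf : f ∈ Submodule.span K (word K '' σ.words)) : σ.coord s f = 0 := by
  have : Submodule.span K (word K '' σ.words) ≤ LinearMap.ker (σ.coord s) := by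
    rw [Submodule.span_le]
    rintro _ ⟨w, hw, rfl⟩
    exact σ.coord_word hs hw
  exact this hf

theorem coord_gen {s t : List X} (hs : s ∈ σ.frontier) (ht : t ∈ σ.frontier) :
    σ.coord s (σ.gen t) = if s = t then 1 else 0 := by
  rw [gen, map_sub, σ.coord_of_mem_span hs (σ.nf_mem _), sub_zero]
  cases s with
  | nil =>
    cases t with
    | nil => simp [coord]
    | cons y w =>
      have := ht.2 y w rfl
      rw [σ.words_eq_empty hs.1] at this
      exact this.elim
  | cons x v =>
    cases t with
    | nil =>
      have := hs.2 x v rfl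
      rw [σ.words_eq_empty ht.1] at this
      exact this.elim
    | cons y w =>
      have hw := ht.2 y w rfl
      have h0 : fox (wordCoeff v ∘ₗ σ.nf) x (word K w) = 0 := σ.coord_word hs hw
      change fox (wordCoeff v ∘ₗ σ.nf) x _ = _
      rw [fox_word_cons, h0, mul_zero, zero_add, LinearMap.comp_apply, σ.nf_word w hw,
        wordCoeff_word]
      by_cases h1 : x = y <;> by_cases h2 : v = w <;> simp [h1, h2, eq_comm]

/-- The elements `gen s` form a basis of `J` as a left module over the free algebra, with
coordinates given by `coord`. -/
theorem exists_eq_sum_coord {f : FreeAlgebra K X} (hf : f ∈ J) :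
    ∃ T : Finset σ.frontier, f = ∑ s ∈ T, σ.coord s f * σ.gen s := by
  obtain ⟨c, hc⟩ := Finsupp.mem_span_range_iff_exists_finsupp.1 (σ.mem_span_gen hf)
  refine ⟨c.support, ?_⟩
  have hcoord : ∀ s : σ.frontier, σ.coord s f = c s := by
    intro s
    rw [← hc, Finsupp.sum, map_sum, Finset.sum_eq_single s]
    · rw [smul_eq_mul, σ.coord_mul _ _ (σ.gen_mem _), σ.coord_gen s.2 s.2, if_pos rfl, mul_one]
    · intro t _ hts
      rw [smul_eq_mul, σ.coord_mul _ _ (σ.gen_mem _), σ.coord_gen s.2 t.2,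
        if_neg fun h => hts (Subtype.ext h.symm), mul_zero]
    · intro hs
      rw [Finsupp.notMem_support_iff.1 hs, zero_smul, map_zero]
  conv_lhs => rw [← hc]
  exact Finset.sum_congr rfl fun s _ => by rw [hcoord]; rfl

end SchreierTransversal

/-! ### The multigrading -/

section Grading

variable {K : Type*} [Field K] {d : ℕ}

/-- The multidegree of a word. -/
def wordDegree (w : List (Fin d)) : Fin d →₀ ℕ := Multiset.toFinsupp (w : Multiset (Fin d))

theorem wordDegree_apply (w : List (Fin d)) (i : Fin d) : wordDegree w i = w.count i := by
  simp [wordDegree]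

theorem wordDegree_append (u v : List (Fin d)) :
    wordDegree (u ++ v) = wordDegree u + wordDegree v := by
  ext i; simp [wordDegree_apply]

theorem wordDegree_cons (i : Fin d) (w : List (Fin d)) :
    wordDegree (i :: w) = Finsupp.single i 1 + wordDegree w := by
  ext j
  rw [Finsupp.add_apply, wordDegree_apply, wordDegree_apply, List.count_cons,
    Finsupp.single_apply, add_comm]
  simp

theorem wordDegree_eq_iff {w : List (Fin d)} {n : Fin d →₀ ℕ} :
    wordDegree w = n ↔ ∀ i, w.count i = n i := by
  simp [Finsupp.ext_iff, wordDegree_apply]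

theorem finite_wordDegree_eq (n : Fin d →₀ ℕ) : {w : List (Fin d) | wordDegree w = n}.Finite := by
  refine (List.finite_length_eq (Fin d) n.degree).subset ?_
  rintro w rfl
  change w.length = _
  induction w with
  | nil => simp [wordDegree]
  | cons i w ih => rw [wordDegree_cons, map_add, ← ih, List.length_cons, Finsupp.degree_single,
      add_comm]

theorem freeComponent_eq_span (n : Fin d →₀ ℕ) :
    freeComponent K d n = Submodule.span K (word K '' {w | wordDegree w = n}) := by
  simp only [wordDegree_eq_iff]
  rfl

theorem word_mem_freeComponent (w : List (Fin d)) :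
    word K w ∈ freeComponent K d (wordDegree w) := by
  rw [freeComponent_eq_span]
  exact Submodule.subset_span ⟨w, rfl, rfl⟩

theorem word_mul_mem_freeComponent (u : List (Fin d)) {n : Fin d →₀ ℕ}
    {f : FreeAlgebra K (Fin d)} (hf : f ∈ freeComponent K d n) :
    word K u * f ∈ freeComponent K d (wordDegree u + n) := by
  have : freeComponent K d n ≤
      (freeComponent K d (wordDegree u + n)).comap (LinearMap.mulLeft K (word K u)) := by
    rw [freeComponent_eq_span, Submodule.span_le]
    rintro _ ⟨w, rfl, rfl⟩
    rw [SetLike.mem_coe, Submodule.mem_comap, LinearMap.mulLeft_apply, ← word_append,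
      ← wordDegree_append]
    exact word_mem_freeComponent _
  exact this hf

/-- The projection of the free algebra onto its homogeneous component of multidegree `n`. -/
def homogProj (K : Type*) [Field K] {d : ℕ} (n : Fin d →₀ ℕ) :
    FreeAlgebra K (Fin d) →ₗ[K] FreeAlgebra K (Fin d) :=
  wordLift fun w => if wordDegree w = n then word K w else 0

theorem homogProj_word (n : Fin d →₀ ℕ) (w : List (Fin d)) :
    homogProj K n (word K w) = if wordDegree w = n then word K w else 0 :=
  wordLift_word _ _

theorem homogProj_of_mem {m : Fin d →₀ ℕ} (n : Fin d →₀ ℕ) {f : FreeAlgebra K (Fin d)}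
    (hf : f ∈ freeComponent K d m) : homogProj K n f = if m = n then f else 0 := by
  have : freeComponent K d m ≤
      LinearMap.eqLocus (homogProj K n) (if m = n then LinearMap.id else 0) := by
    rw [freeComponent_eq_span, Submodule.span_le]
    rintro _ ⟨w, rfl, rfl⟩
    rw [SetLike.mem_coe, LinearMap.mem_eqLocus, homogProj_word]
    split_ifs <;> rfl
  have := this hf
  rw [LinearMap.mem_eqLocus] at this
  rw [this]
  split_ifs <;> rfl

theorem homogProj_mem (n : Fin d →₀ ℕ) (f : FreeAlgebra K (Fin d)) :
    homogProj K n f ∈ freeComponent K d n := by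
  refine mem_of_word_mem ((freeComponent K d n).comap (homogProj K n)) (fun w => ?_) f
  rw [Submodule.mem_comap, homogProj_word]
  split_ifs with h
  · subst h
    exact word_mem_freeComponent w
  · exact zero_mem _

/-- A left ideal of the free algebra is multihomogeneous if it contains the homogeneous components
of its elements. -/
def IsMultihomogeneous (J : Ideal (FreeAlgebra K (Fin d))) : Prop :=
  ∀ f ∈ J, ∀ n, homogProj K n f ∈ J

/-- Over an infinite field T-ideals are multihomogeneous: rescaling the variables by `λ` multiplies
the component of multidegree `n` by `λⁿ`, and a polynomial in `λ` that vanishes identically has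
zero coefficients. -/
theorem isMultihomogeneous_tIdealIn [Infinite K] (R : Type*) [Ring R] [Algebra K R] (d : ℕ) :
    IsMultihomogeneous (tIdealIn K R d) := by
  intro f hf n
  rw [mem_tIdealIn] at hf ⊢
  intro r
  rw [← Module.forall_dual_apply_eq_zero_iff K]
  intro ψ
  -- the polynomial `λ ↦ ψ (f (λ₁ r₁, …, λ_d r_d))`
  let Q : FreeAlgebra K (Fin d) →ₗ[K] MvPolynomial (Fin d) K := wordLift fun w =>
    MvPolynomial.monomial (wordDegree w) (ψ (FreeAlgebra.lift K r (word K w)))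
  have heval : ∀ c : Fin d → K, (MvPolynomial.aeval c).toLinearMap ∘ₗ Q =
      ψ ∘ₗ (FreeAlgebra.lift K fun i => c i • r i).toLinearMap := by
    intro c
    refine wordLinearMap_ext fun w => ?_
    have hw : FreeAlgebra.lift K (fun i => c i • r i) (word K w) =
        MvPolynomial.aeval c (MvPolynomial.monomial (wordDegree w) (1 : K)) •
          FreeAlgebra.lift K r (word K w) := by
      induction w with
      | nil => simp [wordDegree]
      | cons i w ih =>
        have hm : MvPolynomial.monomial (wordDegree (i :: w)) (1 : K) =
            MvPolynomial.X i * MvPolynomial.monomial (wordDegree w) 1 := by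
          rw [wordDegree_cons, MvPolynomial.X, MvPolynomial.monomial_mul, one_mul]
        rw [word_cons, map_mul, map_mul, FreeAlgebra.lift_ι_apply, FreeAlgebra.lift_ι_apply, ih,
          hm, map_mul, MvPolynomial.aeval_X, smul_mul_smul_comm]
    simp only [LinearMap.comp_apply, AlgHom.toLinearMap_apply, hw, map_smul, Q, wordLift_word]
    conv_lhs => rw [← mul_one (ψ _), ← smul_eq_mul, ← MvPolynomial.smul_monomial, map_smul]
    rw [smul_eq_mul, smul_eq_mul, mul_comm]
  have hcoeff : MvPolynomial.lcoeff K n ∘ₗ Q =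
      ψ ∘ₗ (FreeAlgebra.lift K r).toLinearMap ∘ₗ homogProj K n := by
    refine wordLinearMap_ext fun w => ?_
    simp only [LinearMap.comp_apply, Q, wordLift_word, homogProj_word, MvPolynomial.lcoeff_apply,
      MvPolynomial.coeff_monomial]
    split_ifs <;> simp
  have hQ : Q f = 0 := by
    refine MvPolynomial.funext fun c => ?_
    have := LinearMap.congr_fun (heval c) f
    simp only [LinearMap.comp_apply, AlgHom.toLinearMap_apply, hf, map_zero] at this
    rw [map_zero, ← this, MvPolynomial.aeval_eq_eval]
  have := LinearMap.congr_fun hcoeff f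
  simp only [LinearMap.comp_apply, hQ, map_zero] at this
  exact this.symm

/-- The generators of a multihomogeneous left ideal are multihomogeneous: the normal form of a word
lies in the component of this word, by uniqueness of the normal form. -/
theorem SchreierTransversal.gen_mem_freeComponent {J : Ideal (FreeAlgebra K (Fin d))}
    (σ : SchreierTransversal J) (hJ : IsMultihomogeneous J) (s : List (Fin d)) :
    σ.gen s ∈ freeComponent K d (wordDegree s) := by
  set n := wordDegree s
  have hstab : Submodule.span K (word K '' σ.words) ≤
      (Submodule.span K (word K '' σ.words)).comap (homogProj K n) := by
    rw [Submodule.span_le]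
    rintro _ ⟨w, hw, rfl⟩
    rw [SetLike.mem_coe, Submodule.mem_comap, homogProj_word]
    split_ifs
    · exact Submodule.subset_span ⟨w, hw, rfl⟩
    · exact zero_mem _
  have h := σ.nf_eq_zero _ (hJ _ (σ.gen_mem s) n)
  have hn : homogProj K n (word K s) = word K s := by rw [homogProj_word, if_pos rfl]
  rw [gen, map_sub, map_sub, σ.nf_of_mem_span (hstab (σ.nf_mem _)), sub_eq_zero, hn] at h
  rw [gen]
  refine sub_mem (word_mem_freeComponent s) ?_
  rw [h]
  exact homogProj_mem _ _

end Grading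

/-! ### Generating series of graded sets -/

section CardSeries

variable {d : ℕ}

/-- The generating series `∑ₙ #{k | deg k = n} tⁿ` of a family of multidegrees. -/
def cardSeries {κ : Type*} (deg : κ → Fin d →₀ ℕ) : MvPowerSeries (Fin d) ℤ :=
  fun n => (Nat.card {k // deg k = n} : ℤ)

theorem coeff_cardSeries {κ : Type*} (deg : κ → Fin d →₀ ℕ) (n : Fin d →₀ ℕ) :
    MvPowerSeries.coeff n (cardSeries deg) = (Nat.card {k // deg k = n} : ℤ) := rfl

theorem cardSeries_equiv {κ κ' : Type*} (e : κ ≃ κ') (deg : κ' → Fin d →₀ ℕ) :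
    cardSeries (deg ∘ e) = cardSeries deg := by
  ext n
  rw [coeff_cardSeries, coeff_cardSeries]
  exact congrArg _ (Nat.card_congr (e.subtypeEquiv fun k => Iff.rfl))

theorem cardSeries_sum {κ κ' : Type*} (deg : κ → Fin d →₀ ℕ) (deg' : κ' → Fin d →₀ ℕ)
    (h : ∀ n, Finite {k // deg k = n}) (h' : ∀ n, Finite {k // deg' k = n}) :
    cardSeries (Sum.elim deg deg') = cardSeries deg + cardSeries deg' := by
  ext n
  rw [map_add, coeff_cardSeries, coeff_cardSeries, coeff_cardSeries]
  have := h n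
  have := h' n
  rw [← Nat.cast_add, ← Nat.card_sum]
  exact congrArg _ (Nat.card_congr (Equiv.subtypeSum (p := fun k => Sum.elim deg deg' k = n)))

/-- A pair of total degree `n` consists of two members whose degrees form a decomposition of `n`. -/
def prodFiberEquiv {κ κ' : Type*} (deg : κ → Fin d →₀ ℕ) (deg' : κ' → Fin d →₀ ℕ)
    (n : Fin d →₀ ℕ) : {k : κ × κ' // deg k.1 + deg' k.2 = n} ≃
      Σ p : Finset.HasAntidiagonal.antidiagonal n,
        {k // deg k = p.1.1} × {k // deg' k = p.1.2} where
  toFun k := ⟨⟨(deg k.1.1, deg' k.1.2), Finset.HasAntidiagonal.mem_antidiagonal.2 k.2⟩,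
    ⟨k.1.1, rfl⟩, ⟨k.1.2, rfl⟩⟩
  invFun x := ⟨(x.2.1.1, x.2.2.1), by
    rw [x.2.1.2, x.2.2.2]
    exact Finset.HasAntidiagonal.mem_antidiagonal.1 x.1.2⟩
  left_inv _ := rfl
  right_inv := by
    rintro ⟨⟨⟨a, b⟩, hab⟩, ⟨k, hk⟩, ⟨k', hk'⟩⟩
    dsimp only at hk hk'
    subst hk hk'
    rfl

theorem finite_prod_fiber {κ κ' : Type*} {deg : κ → Fin d →₀ ℕ} {deg' : κ' → Fin d →₀ ℕ}
    (h : ∀ n, Finite {k // deg k = n}) (h' : ∀ n, Finite {k // deg' k = n}) (n : Fin d →₀ ℕ) :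
    Finite {k : κ × κ' // deg k.1 + deg' k.2 = n} :=
  Finite.of_equiv _ (prodFiberEquiv deg deg' n).symm

theorem cardSeries_prod {κ κ' : Type*} (deg : κ → Fin d →₀ ℕ) (deg' : κ' → Fin d →₀ ℕ)
    (h : ∀ n, Finite {k // deg k = n}) (h' : ∀ n, Finite {k // deg' k = n}) :
    cardSeries (fun k : κ × κ' => deg k.1 + deg' k.2) = cardSeries deg * cardSeries deg' := by
  classical
  ext n
  rw [MvPowerSeries.coeff_mul, coeff_cardSeries, Nat.card_congr (prodFiberEquiv deg deg' n),
    Nat.card_sigma]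
  simp only [coeff_cardSeries, ← Nat.cast_mul, ← Nat.card_prod]
  rw [← Nat.cast_sum]
  exact congrArg _ (Finset.sum_coe_sort (Finset.HasAntidiagonal.antidiagonal n)
    fun p => Nat.card ({k // deg k = p.1} × {k // deg' k = p.2}))

theorem finite_words_fiber (T : Set (List (Fin d))) (n : Fin d →₀ ℕ) :
    Finite {w : T // wordDegree w.1 = n} :=
  have := (finite_wordDegree_eq n).to_subtype
  Finite.of_injective (fun w => (⟨w.1.1, w.2⟩ : {w : List (Fin d) | wordDegree w = n}))
    fun _ _ hab => Subtype.ext (Subtype.ext (Subtype.mk.inj hab))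

theorem cardSeries_unit : cardSeries (fun _ : Unit => (0 : Fin d →₀ ℕ)) = 1 := by
  classical
  ext n
  rw [coeff_cardSeries, MvPowerSeries.coeff_one]
  split_ifs with h
  · subst h
    simp
  · have : IsEmpty {k : Unit // (0 : Fin d →₀ ℕ) = n} := ⟨fun k => h k.2.symm⟩
    simp

theorem cardSeries_single : cardSeries (fun i : Fin d => Finsupp.single i 1) =
    ∑ i, (MvPowerSeries.X i : MvPowerSeries (Fin d) ℤ) := by
  classical
  ext n
  rw [coeff_cardSeries, map_sum]
  simp only [MvPowerSeries.coeff_X]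
  rw [Finset.sum_boole, Nat.card_eq_fintype_card, Fintype.card_subtype]
  simp only [eq_comm]

/-- The words that are empty or arise from a word of a suffix-closed set by prefixing a variable are
the words of this set together with its frontier. -/
theorem SchreierTransversal.cardSeries_frontier {K : Type*} [Field K]
    {J : Ideal (FreeAlgebra K (Fin d))} (σ : SchreierTransversal J) :
    cardSeries (fun s : σ.frontier => wordDegree s.1) =
      1 + ((∑ i, MvPowerSeries.X i) - 1) * cardSeries (fun w : σ.words => wordDegree w.1) := by
  classical
  let e : σ.words ⊕ σ.frontier ≃ Unit ⊕ Fin d × σ.words :=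
    Equiv.symm <| Equiv.ofBijective
      (fun k => if h : Sum.elim (fun _ => []) (fun k => k.1 :: k.2.1) k ∈ σ.words
        then Sum.inl ⟨_, h⟩
        else Sum.inr ⟨Sum.elim (fun _ => []) (fun k => k.1 :: k.2.1) k, h, by
          rcases k with _ | ⟨i, v⟩
          · rintro _ _ ⟨⟩
          · rintro _ _ ⟨⟩
            exact v.2⟩) <| by
      constructor
      · intro a b hab
        have hab' : Sum.elim (fun _ => []) (fun k : Fin d × σ.words => k.1 :: k.2.1) a =
            Sum.elim (fun _ => []) (fun k => k.1 :: k.2.1) b := by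
          dsimp only at hab
          split_ifs at hab
          · exact Subtype.mk.inj (Sum.inl.inj hab)
          · exact Subtype.mk.inj (Sum.inr.inj hab)
        rcases a with _ | ⟨i, v⟩ <;> rcases b with _ | ⟨j, w⟩
        · rfl
        · simp at hab'
        · simp at hab'
        · simp only [Sum.elim_inr, List.cons.injEq] at hab'
          exact congrArg _ (Prod.ext hab'.1 (Subtype.ext hab'.2))
      · rintro (⟨w, hw⟩ | ⟨w, hw⟩)
        · cases w with
          | nil => exact ⟨Sum.inl (), dif_pos hw⟩
          | cons i v => exact ⟨Sum.inr (i, ⟨v, σ.suffix_mem i v hw⟩), dif_pos hw⟩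
        · cases w with
          | nil => exact ⟨Sum.inl (), dif_neg hw.1⟩
          | cons i v => exact ⟨Sum.inr (i, ⟨v, hw.2 i v rfl⟩), dif_neg hw.1⟩
  have hdeg : Sum.elim (fun w : σ.words => wordDegree w.1)
      (fun s : σ.frontier => wordDegree s.1) ∘ e.symm =
      Sum.elim (fun _ => 0) fun k => Finsupp.single k.1 1 + wordDegree k.2.1 := by
    funext k
    have hk : ∀ k, Sum.elim (fun w : σ.words => wordDegree w.1)
        (fun s : σ.frontier => wordDegree s.1) (e.symm k) =
        wordDegree (Sum.elim (fun _ => []) (fun k => k.1 :: k.2.1) k) := by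
      intro k
      change Sum.elim (fun w : σ.words => wordDegree w.1)
        (fun s : σ.frontier => wordDegree s.1) (dite _ _ _) = _
      split_ifs <;> rfl
    rw [Function.comp_apply, hk]
    rcases k with _ | ⟨i, v⟩
    · simp [wordDegree]
    · exact wordDegree_cons i v.1
  have h := cardSeries_equiv e.symm (Sum.elim (fun w : σ.words => wordDegree w.1)
    (fun s : σ.frontier => wordDegree s.1))
  rw [hdeg, cardSeries_sum _ _ (fun n => inferInstance)
      (finite_prod_fiber (deg := fun i : Fin d => Finsupp.single i 1) (fun n => inferInstance)
        (finite_words_fiber σ.words)),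
    cardSeries_sum _ _ (finite_words_fiber _) (finite_words_fiber _), cardSeries_unit,
    cardSeries_prod (fun i : Fin d => Finsupp.single i 1) (fun w : σ.words => wordDegree w.1)
      (fun n => inferInstance) (finite_words_fiber _), cardSeries_single] at h
  linear_combination -h

end CardSeries

/-! ### The Hilbert series of a product of T-ideals -/

section Hilbert

variable {K : Type*} [Field K] {d : ℕ}

/-- If a family `e` of multihomogeneous elements spans the free algebra modulo `T(R)` and has a
dual family of linear functionals that vanish on `T(R)`, then the Hilbert series of the relatively
free algebra counts the members of the family by multidegree. -/
theorem relFreeHilbert_eq_cardSeries {R : Type*} [Ring R] [Algebra K R]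
    (hL : IsMultihomogeneous (tIdealIn K R d)) {κ : Type*} [DecidableEq κ]
    (e : κ → FreeAlgebra K (Fin d)) (deg : κ → Fin d →₀ ℕ)
    (he : ∀ k, e k ∈ freeComponent K d (deg k))
    (θ : κ → FreeAlgebra K (Fin d) →ₗ[K] K) (hθ : ∀ k, ∀ f ∈ tIdealIn K R d, θ k f = 0)
    (hθe : ∀ k l, θ k (e l) = if k = l then 1 else 0)
    (hspan : ∀ f, ∃ l ∈ Submodule.span K (Set.range e), f - l ∈ tIdealIn K R d) :
    relFreeHilbert K R d = cardSeries deg := by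
  funext n
  change (finrank K (relFreeComponent K R d n) : ℤ) = (Nat.card {k // deg k = n} : ℤ)
  congr 1
  set π := (Ideal.Quotient.mkₐ K (tIdealIn K R d)).toLinearMap
  have hπ : ∀ f, π f = 0 ↔ f ∈ tIdealIn K R d := fun f => Ideal.Quotient.eq_zero_iff_mem
  have hli : LinearIndependent K fun k : {k // deg k = n} => π (e k) := by
    rw [linearIndependent_iff']
    intro s c hc k hk
    have hmem : ∑ i ∈ s, c i • e i ∈ tIdealIn K R d := by
      rw [← hπ, map_sum]
      simpa only [map_smul] using hc
    have h := hθ k _ hmem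
    rw [map_sum, Finset.sum_eq_single k] at h
    · simpa [hθe] using h
    · intro i _ hik
      rw [map_smul, hθe, if_neg fun h => hik (Subtype.ext h.symm), smul_zero]
    · exact fun h => (h hk).elim
  have hproj : Submodule.span K (Set.range e) ≤ (Submodule.span K
      (Set.range fun k : {k // deg k = n} => e k)).comap (homogProj K n) := by
    rw [Submodule.span_le]
    rintro _ ⟨k, rfl⟩
    rw [SetLike.mem_coe, Submodule.mem_comap, homogProj_of_mem n (he k)]
    split_ifs with h
    · exact Submodule.subset_span ⟨⟨k, h⟩, rfl⟩
    · exact zero_mem _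
  have hcomp : relFreeComponent K R d n =
      Submodule.span K (Set.range fun k : {k // deg k = n} => π (e k)) := by
    have hr : (Set.range fun k : {k // deg k = n} => π (e k)) =
        π '' Set.range fun k : {k // deg k = n} => e k := (Set.range_comp _ _)
    rw [hr, ← Submodule.map_span]
    refine le_antisymm ?_ (Submodule.map_mono ?_)
    · rintro _ ⟨f, hf, rfl⟩
      obtain ⟨l, hl, hfl⟩ := hspan f
      refine ⟨homogProj K n l, hproj hl, ?_⟩
      have := hL _ hfl n
      rw [map_sub, homogProj_of_mem n hf, if_pos rfl, ← hπ, map_sub, sub_eq_zero] at this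
      exact this.symm
    · rw [Submodule.span_le]
      rintro _ ⟨k, rfl⟩
      have := he k
      rwa [k.2] at this
  rw [hcomp]
  exact finrank_eq_nat_card_basis (Basis.span hli)

theorem SchreierTransversal.relFreeHilbert_eq {R : Type*} [Ring R] [Algebra K R]
    (hL : IsMultihomogeneous (tIdealIn K R d)) (σ : SchreierTransversal (tIdealIn K R d)) :
    relFreeHilbert K R d = cardSeries fun w : σ.words => wordDegree w.1 := by
  classical
  refine relFreeHilbert_eq_cardSeries hL (fun w => word K w.1) _
    (fun w => word_mem_freeComponent w.1) (fun w => wordCoeff w.1 ∘ₗ σ.nf) (fun w f hf => ?_)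
    (fun v w => ?_) fun f => ⟨σ.nf f, ?_, σ.sub_nf_mem f⟩
  · rw [LinearMap.comp_apply, σ.nf_eq_zero f hf, map_zero]
  · rw [LinearMap.comp_apply, σ.nf_word w.1 w.2, wordCoeff_word]
    simp only [Subtype.ext_iff, eq_comm]
  · have := σ.nf_mem f
    rwa [Set.image_eq_range] at this

/-- Formanek's formula for the Hilbert series of a product of T-ideals, with the product `T(A) T(C)`
described as the set of elements of `T(C)` whose coordinates with respect to the free generators
of the left ideal `T(C)` lie in `T(A)`. -/
theorem relFreeHilbert_of_coord {A C R : Type*} [Ring A] [Algebra K A] [Ring C] [Algebra K C]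
    [Ring R] [Algebra K R] (hA : IsMultihomogeneous (tIdealIn K A d))
    (hC : IsMultihomogeneous (tIdealIn K C d)) (hR : IsMultihomogeneous (tIdealIn K R d))
    (σ : SchreierTransversal (tIdealIn K C d))
    (h : ∀ f, f ∈ tIdealIn K R d ↔
      f ∈ tIdealIn K C d ∧ ∀ s ∈ σ.frontier, σ.coord s f ∈ tIdealIn K A d) :
    1 + ((∑ i, MvPowerSeries.X i) - 1) * relFreeHilbert K R d =
      (1 + ((∑ i, MvPowerSeries.X i) - 1) * relFreeHilbert K A d) *
        (1 + ((∑ i, MvPowerSeries.X i) - 1) * relFreeHilbert K C d) := by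
  classical
  obtain ⟨τ⟩ := exists_schreierTransversal (tIdealIn K A d)
  -- a basis modulo `T(R)`: the transversal of `T(C)`, and the multiples of the generators of
  -- `T(C)` by the transversal of `T(A)`
  let e : σ.words ⊕ τ.words × σ.frontier → FreeAlgebra K (Fin d) :=
    Sum.elim (fun w => word K w.1) fun k => word K k.1.1 * σ.gen k.2.1
  let θ : σ.words ⊕ τ.words × σ.frontier → FreeAlgebra K (Fin d) →ₗ[K] K :=
    Sum.elim (fun w => wordCoeff w.1 ∘ₗ σ.nf)
      fun k => wordCoeff k.1.1 ∘ₗ τ.nf ∘ₗ σ.coord k.2.1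
  have hmul : ∀ f ∈ tIdealIn K A d, ∀ s : σ.frontier, f * σ.gen s ∈ tIdealIn K R d := by
    intro f hf s
    refine (h _).2 ⟨Ideal.mul_mem_left _ _ (σ.gen_mem _), fun t ht => ?_⟩
    rw [σ.coord_mul _ _ (σ.gen_mem _), σ.coord_gen ht s.2]
    split_ifs
    · rwa [mul_one]
    · rw [mul_zero]
      exact zero_mem _
  have hseries : relFreeHilbert K R d = cardSeries (Sum.elim (fun w : σ.words => wordDegree w.1)
      fun k : τ.words × σ.frontier => wordDegree k.1.1 + wordDegree k.2.1) := by
    refine relFreeHilbert_eq_cardSeries hR e _ ?_ θ ?_ ?_ ?_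
    · rintro (w | k)
      · exact word_mem_freeComponent _
      · exact word_mul_mem_freeComponent _ (σ.gen_mem_freeComponent hC _)
    · rintro (w | k) f hf
      · simp [θ, σ.nf_eq_zero f ((h f).1 hf).1]
      · simp [θ, τ.nf_eq_zero _ (((h f).1 hf).2 _ k.2.2)]
    · rintro (v | k) (w | l)
      · simp only [θ, e, Sum.elim_inl, LinearMap.comp_apply, σ.nf_word w.1 w.2, wordCoeff_word,
          Sum.inl.injEq, Subtype.ext_iff, eq_comm]
      · simp [θ, e, σ.nf_eq_zero _ (Ideal.mul_mem_left _ _ (σ.gen_mem _))]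
      · simp [θ, e, σ.coord_word k.2.2 w.2]
      · simp only [θ, e, Sum.elim_inr, LinearMap.comp_apply, σ.coord_mul _ _ (σ.gen_mem _),
          σ.coord_gen k.2.2 l.2.2]
        by_cases h2 : k.2 = l.2
        · rw [if_pos (congrArg _ h2), mul_one, τ.nf_word _ l.1.2, wordCoeff_word]
          simp only [Sum.inr.injEq, Prod.ext_iff, h2, and_true, Subtype.ext_iff, eq_comm]
        · rw [if_neg fun hh => h2 (Subtype.ext hh), mul_zero, map_zero, map_zero, if_neg]
          rintro ⟨⟩
          exact h2 rfl
    · intro f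
      obtain ⟨T, hT⟩ := σ.exists_eq_sum_coord (σ.sub_nf_mem f)
      set g := f - σ.nf f with hg
      refine ⟨σ.nf f + ∑ s ∈ T, τ.nf (σ.coord s g) * σ.gen s, add_mem ?_ (sum_mem fun s _ => ?_),
        ?_⟩
      · refine Submodule.span_mono ?_ (σ.nf_mem f)
        rintro _ ⟨w, hw, rfl⟩
        exact ⟨Sum.inl ⟨w, hw⟩, rfl⟩
      · have hle : Submodule.span K (word K '' τ.words) ≤
            (Submodule.span K (Set.range e)).comap (LinearMap.mulRight K (σ.gen s)) := by
          rw [Submodule.span_le]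
          rintro _ ⟨w, hw, rfl⟩
          exact Submodule.subset_span ⟨Sum.inr (⟨w, hw⟩, s), rfl⟩
        exact hle (τ.nf_mem _)
      · rw [← sub_sub, ← hg]
        nth_rw 1 [hT]
        rw [← Finset.sum_sub_distrib]
        refine sum_mem fun s _ => ?_
        rw [← sub_mul]
        exact hmul _ (τ.sub_nf_mem _) s
  rw [hseries, cardSeries_sum _ _ (finite_words_fiber _)
      (finite_prod_fiber (finite_words_fiber _) (finite_words_fiber _)),
    cardSeries_prod (fun w : τ.words => wordDegree w.1) (fun s : σ.frontier => wordDegree s.1)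
      (finite_words_fiber _) (finite_words_fiber _), σ.cardSeries_frontier,
    ← σ.relFreeHilbert_eq hC, ← τ.relFreeHilbert_eq hA]
  ring

end Hilbert

/-! ### Identities of block triangular matrices with two diagonal blocks -/

section Blocks

variable {K : Type*} [Field K] {d : ℕ} {α β : Type*} [Fintype α] [DecidableEq α]
  [Fintype β] [DecidableEq β]

theorem exists_lift_fromBlocks (a : Fin d → Matrix α α K) (m : Fin d → Matrix α β K)
    (c : Fin d → Matrix β β K) (f : FreeAlgebra K (Fin d)) :
    ∃ m' : Matrix α β K, FreeAlgebra.lift K (fun i => Matrix.fromBlocks (a i) (m i) 0 (c i)) f =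
      Matrix.fromBlocks (FreeAlgebra.lift K a f) m' 0 (FreeAlgebra.lift K c f) := by
  induction f with
  | grade0 r =>
    refine ⟨0, ?_⟩
    simp only [AlgHom.commutes]
    simp only [Algebra.algebraMap_eq_smul_one]
    rw [← Matrix.fromBlocks_one, Matrix.fromBlocks_smul, smul_zero, smul_zero]
  | grade1 i => exact ⟨m i, by simp⟩
  | mul f g hf hg =>
    obtain ⟨m₁, h₁⟩ := hf
    obtain ⟨m₂, h₂⟩ := hg
    exact ⟨_, by rw [map_mul, h₁, h₂, Matrix.fromBlocks_multiply, map_mul, map_mul]; simp; rfl⟩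
  | add f g hf hg =>
    obtain ⟨m₁, h₁⟩ := hf
    obtain ⟨m₂, h₂⟩ := hg
    exact ⟨_, by rw [map_add, h₁, h₂, Matrix.fromBlocks_add, map_add, map_add, add_zero]⟩

/-- The Fox derivative dual to `fox`, with the left-hand factors evaluated at matrices: a word `w`
goes to the vector with entries `∑ u(a)_{p q} v`, the sum over all factorizations `w = u x_i v`. -/
def evalFoxWord (a : Fin d → Matrix α α K) (i : Fin d) (q : α) :
    List (Fin d) → α → FreeAlgebra K (Fin d)
  | [] => 0
  | j :: w => fun p => ∑ p', a j p p' • evalFoxWord a i q w p' +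
      if i = j ∧ p = q then word K w else 0

/-- The linear extension of `evalFoxWord`. -/
def evalFox (a : Fin d → Matrix α α K) (i : Fin d) (q : α) :
    FreeAlgebra K (Fin d) →ₗ[K] α → FreeAlgebra K (Fin d) :=
  wordLift (evalFoxWord a i q)

/-- Both sides are `∑ φ(v) u(a)_{p q}` over the factorizations `u x_i v` of the words of `f`. -/
theorem map_evalFox (a : Fin d → Matrix α α K) (i : Fin d) (p q : α)
    (φ : FreeAlgebra K (Fin d) →ₗ[K] K) (f : FreeAlgebra K (Fin d)) :
    φ (evalFox a i q f p) = FreeAlgebra.lift K a (fox φ i f) p q := by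
  have h : φ ∘ₗ LinearMap.proj p ∘ₗ evalFox a i q =
      Matrix.entryLinearMap K K p q ∘ₗ (FreeAlgebra.lift K a).toLinearMap ∘ₗ fox φ i := by
    refine wordLinearMap_ext fun w => ?_
    change φ (evalFox a i q (word K w) p) = FreeAlgebra.lift K a (fox φ i (word K w)) p q
    rw [evalFox, wordLift_word]
    induction w generalizing p with
    | nil => simp [evalFoxWord]
    | cons j w ih =>
      rw [fox_word_cons, map_add, map_mul, FreeAlgebra.lift_ι_apply, Matrix.add_apply,
        Matrix.mul_apply, evalFoxWord, map_add, map_sum]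
      simp only [map_smul, ih, smul_eq_mul]
      congr 1
      by_cases h1 : i = j
      · by_cases h2 : p = q <;> simp [h1, h2, Matrix.algebraMap_matrix_apply]
      · simp [h1]
  exact LinearMap.congr_fun h f

/-- Evaluating `evalFox` gives the entries of the off-diagonal block of the value of `f` at block
triangular matrices of which only the one for `x_i` has a nonzero off-diagonal block, a matrix
unit. -/
theorem lift_evalFox (a : Fin d → Matrix α α K) (c : Fin d → Matrix β β K) (i : Fin d) (p q : α)
    (r r' : β) (f : FreeAlgebra K (Fin d)) :
    FreeAlgebra.lift K c (evalFox a i q f p) r r' =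
      FreeAlgebra.lift K (fun j => Matrix.fromBlocks (a j)
        (if i = j then Matrix.single q r (1 : K) else 0) 0 (c j)) f (Sum.inl p) (Sum.inr r') := by
  set Z := FreeAlgebra.lift K (fun j => Matrix.fromBlocks (a j)
        (if i = j then Matrix.single q r (1 : K) else 0) 0 (c j)) with hZ
  have h : Matrix.entryLinearMap K K r r' ∘ₗ (FreeAlgebra.lift K c).toLinearMap ∘ₗ
      LinearMap.proj p ∘ₗ evalFox a i q =
      Matrix.entryLinearMap K K (Sum.inl p) (Sum.inr r') ∘ₗ Z.toLinearMap := by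
    refine wordLinearMap_ext fun w => ?_
    change FreeAlgebra.lift K c (evalFox a i q (word K w) p) r r' =
      Z (word K w) (Sum.inl p) (Sum.inr r')
    rw [evalFox, wordLift_word]
    induction w generalizing p with
    | nil => simp [evalFoxWord]
    | cons j w ih =>
      have h22 : ∀ s, Z (word K w) (Sum.inr s) (Sum.inr r') =
          FreeAlgebra.lift K c (word K w) s r' := by
        intro s
        obtain ⟨m', h'⟩ := exists_lift_fromBlocks a
          (fun j => if i = j then Matrix.single q r (1 : K) else 0) c (word K w)
        rw [hZ, h']
        rfl
      rw [word_cons, map_mul, Matrix.mul_apply, Fintype.sum_sum_type, evalFoxWord, map_add,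
        Matrix.add_apply, map_sum, Matrix.sum_apply]
      simp only [h22, ← ih]
      rw [hZ, FreeAlgebra.lift_ι_apply]
      simp only [Matrix.fromBlocks_apply₁₁, Matrix.fromBlocks_apply₁₂, map_smul, Matrix.smul_apply,
        smul_eq_mul]
      congr 1
      by_cases h1 : i = j
      · by_cases h2 : p = q
        · simp [h1, h2, Matrix.single_apply]
        · simp [h1, h2, Ne.symm h2]
      · simp [h1]
  exact LinearMap.congr_fun h f

/-- Lewin's theorem for block triangular matrices with a full matrix algebra in the upper left
corner and a matrix algebra `C` in the lower right corner: the polynomials vanishing on them form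
the product of the T-ideals of the two diagonal blocks, that is, they are the elements of `T(C)`
whose coordinates with respect to the free generators of `T(C)` are identities of the first
block. -/
theorem lift_fromBlocks_eq_zero_iff (C : Subalgebra K (Matrix β β K))
    (σ : SchreierTransversal (tIdealIn K C d)) (f : FreeAlgebra K (Fin d)) :
    (∀ (a : Fin d → Matrix α α K) (m : Fin d → Matrix α β K) (c : Fin d → C),
      FreeAlgebra.lift K (fun i => Matrix.fromBlocks (a i) (m i) 0 (c i : Matrix β β K)) f = 0) ↔
    f ∈ tIdealIn K C d ∧ ∀ s ∈ σ.frontier, σ.coord s f ∈ tIdealIn K (Matrix α α K) d := by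
  have hval : ∀ (c : Fin d → C) (g : FreeAlgebra K (Fin d)),
      FreeAlgebra.lift K (fun i => (c i : Matrix β β K)) g = (FreeAlgebra.lift K c g : C) := by
    intro c g
    have : FreeAlgebra.lift K (fun i => (c i : Matrix β β K)) =
        C.val.comp (FreeAlgebra.lift K c) := by
      ext i
      simp
    rw [this]
    rfl
  constructor
  · intro H
    refine ⟨mem_tIdealIn.2 fun c => ?_, fun s hs => mem_tIdealIn.2 fun a => ?_⟩
    · obtain ⟨m', h'⟩ := exists_lift_fromBlocks (0 : Fin d → Matrix α α K) 0 (fun i => (c i).1) f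
      have h0 := (H 0 0 c).symm.trans h'
      rw [← Matrix.fromBlocks_zero, Matrix.fromBlocks_inj, hval] at h0
      exact Subtype.ext h0.2.2.2.symm
    · cases s with
      | nil =>
        obtain ⟨m', h'⟩ := exists_lift_fromBlocks a (0 : Fin d → Matrix α β K) 0 f
        have h0 := (H a 0 0).symm.trans h'
        rw [← Matrix.fromBlocks_zero, Matrix.fromBlocks_inj] at h0
        exact h0.1.symm
      | cons i v =>
        ext p q
        change FreeAlgebra.lift K a (fox (wordCoeff v ∘ₗ σ.nf) i f) p q = 0
        -- the arguments `c` vary freely while `a` is fixed, so `evalFox` is an identity of `C`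
        have hmem : evalFox a i q f p ∈ tIdealIn K C d := by
          refine mem_tIdealIn.2 fun c => Subtype.ext ?_
          rw [← hval]
          ext r r'
          rw [lift_evalFox, H]
          rfl
        rw [← map_evalFox, LinearMap.comp_apply, σ.nf_eq_zero _ hmem, map_zero]
  · rintro ⟨hf, hcoord⟩ a m c
    obtain ⟨T, hT⟩ := σ.exists_eq_sum_coord hf
    rw [hT, map_sum]
    refine Finset.sum_eq_zero fun s _ => ?_
    obtain ⟨m₁, h₁⟩ := exists_lift_fromBlocks a m (fun i => (c i).1) (σ.coord s f)
    obtain ⟨m₂, h₂⟩ := exists_lift_fromBlocks a m (fun i => (c i).1) (σ.gen s)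
    rw [map_mul, h₁, h₂, mem_tIdealIn.1 (hcoord s s.2) a, hval c (σ.gen s),
      mem_tIdealIn.1 (σ.gen_mem s) c, Matrix.fromBlocks_multiply]
    simp

end Blocks

/-! ### Upper block triangular matrices -/

section UpperBlock

variable {K : Type*} [Field K] {d : ℕ}

/-- The rows of a block matrix are those of its first block together with the remaining ones. -/
def sigmaFinSuccEquiv {m : ℕ} (s : Fin (m + 1) → ℕ) :
    Fin (s 0) ⊕ (Σ i : Fin m, Fin (s i.succ)) ≃ Σ i : Fin (m + 1), Fin (s i) where
  toFun := Sum.elim (fun a => ⟨0, a⟩) fun b => ⟨b.1.succ, b.2⟩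
  invFun x := Fin.cases (motive := fun i => Fin (s i) → Fin (s 0) ⊕ (Σ i : Fin m, Fin (s i.succ)))
    Sum.inl (fun i b => Sum.inr ⟨i, b⟩) x.1 x.2
  left_inv := by rintro (a | ⟨i, b⟩) <;> rfl
  right_inv := by
    rintro ⟨i, b⟩
    induction i using Fin.cases <;> rfl

theorem blockTriangular_iff_exists_fromBlocks {m : ℕ} (s : Fin (m + 1) → ℕ)
    (M : Matrix (Σ i, Fin (s i)) (Σ i, Fin (s i)) K) :
    M.BlockTriangular Sigma.fst ↔
      ∃ (a : Matrix (Fin (s 0)) (Fin (s 0)) K)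
        (b : Matrix (Fin (s 0)) (Σ i : Fin m, Fin (s i.succ)) K)
        (c : UpperBlock K fun i : Fin m => s i.succ),
        M = Matrix.reindexAlgEquiv K K (sigmaFinSuccEquiv s) (Matrix.fromBlocks a b 0 c.1) := by
  set e := sigmaFinSuccEquiv s with he
  constructor
  · intro h
    set M' := (Matrix.reindexAlgEquiv K K e).symm M with hM'
    refine ⟨M'.toBlocks₁₁, M'.toBlocks₁₂, ⟨M'.toBlocks₂₂, ?_⟩, ?_⟩
    · intro x y hxy
      exact h (i := e (Sum.inr x)) (j := e (Sum.inr y)) (Fin.succ_lt_succ_iff.2 hxy)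
    · have h21 : M'.toBlocks₂₁ = 0 := by
        ext x y
        exact h (i := e (Sum.inr x)) (j := e (Sum.inl y)) (Fin.succ_pos _)
      rw [← h21, Matrix.fromBlocks_toBlocks, hM', AlgEquiv.apply_symm_apply]
  · rintro ⟨a, b, c, rfl⟩
    rw [Matrix.coe_reindexAlgEquiv, Matrix.blockTriangular_reindex_iff]
    rintro (x | x) (y | y) hxy
    · exact (lt_irrefl _ hxy).elim
    · exact (not_lt_bot hxy).elim
    · rfl
    · exact c.2 (Fin.succ_lt_succ_iff.1 hxy)

theorem mem_tIdealIn_upperBlock_succ {m : ℕ} (s : Fin (m + 1) → ℕ) (f : FreeAlgebra K (Fin d)) :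
    f ∈ tIdealIn K (UpperBlock K s) d ↔
      ∀ (a : Fin d → Matrix (Fin (s 0)) (Fin (s 0)) K)
        (b : Fin d → Matrix (Fin (s 0)) (Σ i : Fin m, Fin (s i.succ)) K)
        (c : Fin d → UpperBlock K fun i : Fin m => s i.succ),
        FreeAlgebra.lift K (fun i => Matrix.fromBlocks (a i) (b i) 0 (c i).1) f = 0 := by
  have hval : ∀ r : Fin d → UpperBlock K s,
      FreeAlgebra.lift K (fun i => (r i).1) f = (FreeAlgebra.lift K r f).1 := by
    intro r
    have : FreeAlgebra.lift K (fun i => (r i).1) =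
        (Subalgebra.val _).comp (FreeAlgebra.lift K r) := by
      ext i
      simp
    rw [this]
    rfl
  set E := Matrix.reindexAlgEquiv K K (sigmaFinSuccEquiv s)
  have hE : ∀ M : Fin d → Matrix (Fin (s 0) ⊕ Σ i : Fin m, Fin (s i.succ)) _ K,
      FreeAlgebra.lift K (fun i => E (M i)) f = E (FreeAlgebra.lift K M f) := by
    intro M
    have : FreeAlgebra.lift K (fun i => E (M i)) =
        E.toAlgHom.comp (FreeAlgebra.lift K M) := by
      ext i
      simp
    rw [this]
    rfl
  rw [mem_tIdealIn]
  constructor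
  · intro h a b c
    have h' := hval fun i => ⟨E (Matrix.fromBlocks (a i) (b i) 0 (c i).1),
      (blockTriangular_iff_exists_fromBlocks s _).2 ⟨_, _, _, rfl⟩⟩
    rw [h, hE] at h'
    exact E.injective (h'.trans (map_zero E).symm)
  · intro h r
    choose a b c habc using fun i => (blockTriangular_iff_exists_fromBlocks s _).1 (r i).2
    refine Subtype.ext ?_
    rw [← hval, funext habc, hE, h, map_zero]
    rfl

/-- The Hilbert series of the identities of upper block triangular matrices is multiplicative in the
diagonal blocks, in the normalization `1 + (t₁ + ⋯ + t_d - 1) H`. -/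
theorem relFreeHilbert_upperBlock [Infinite K] {m : ℕ} (s : Fin m → ℕ) :
    1 + ((∑ i, MvPowerSeries.X i) - 1) * relFreeHilbert K (UpperBlock K s) d =
      ∏ i, (1 + ((∑ i, MvPowerSeries.X i) - 1) *
        relFreeHilbert K (Matrix (Fin (s i)) (Fin (s i)) K) d) := by
  induction m with
  | zero =>
    have : relFreeHilbert K (UpperBlock K s) d = 0 := by
      funext n
      have hsub : Subsingleton (RelFree K (UpperBlock K s) d) := by
        rw [Ideal.Quotient.subsingleton_iff, Ideal.eq_top_iff_one]
        exact mem_tIdealIn.2 fun r => Subsingleton.elim _ _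
      change (finrank K (relFreeComponent K (UpperBlock K s) d n) : ℤ) = 0
      rw [finrank_zero_of_subsingleton]
      rfl
    rw [this]
    simp
  | succ m ih =>
    obtain ⟨σ⟩ := exists_schreierTransversal
      (tIdealIn K (UpperBlock K fun i : Fin m => s i.succ) d)
    rw [Fin.prod_univ_succ, ← ih fun i => s i.succ]
    exact relFreeHilbert_of_coord (isMultihomogeneous_tIdealIn _ d)
      (isMultihomogeneous_tIdealIn _ d) (isMultihomogeneous_tIdealIn _ d) σ fun f =>
      (mem_tIdealIn_upperBlock_succ s f).trans (lift_fromBlocks_eq_zero_iff _ σ f)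

end UpperBlock

/-! ### The polynomial algebra and the closed form -/

section Polynomial

variable (K : Type*) [Field K] (d : ℕ)

theorem polyHilbert_apply (n : Fin d →₀ ℕ) : MvPowerSeries.coeff n (polyHilbert K d) = 1 := by
  change (finrank K (polyComponent K d n) : ℤ) = 1
  rw [polyComponent, finrank_span_singleton, Nat.cast_one]
  exact (MvPolynomial.monomial_eq_zero).not.2 one_ne_zero

theorem polyHilbert_mul_prod :
    polyHilbert K d * ∏ k : Fin d, (1 - MvPowerSeries.X k) = 1 := by
  classical
  -- the partial products are the generating series of the monomials without the variables in `T`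
  have h : ∀ (T : Finset (Fin d)) n, MvPowerSeries.coeff n
      (polyHilbert K d * ∏ k ∈ T, (1 - MvPowerSeries.X k)) = if ∀ k ∈ T, n k = 0 then 1 else 0 := by
    intro T
    induction T using Finset.induction_on with
    | empty => intro n; simp [polyHilbert_apply]
    | insert k T hk ih =>
      intro n
      rw [Finset.prod_insert hk, mul_left_comm, mul_comm, mul_sub, mul_one, map_sub, ih,
        MvPowerSeries.X, MvPowerSeries.coeff_mul_monomial, mul_one]
      by_cases hn : n k = 0
      · rw [if_neg (c := Finsupp.single k 1 ≤ n)]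
        · simp [hn]
        · intro hle
          have := hle k
          simp [hn] at this
      · have hle : Finsupp.single k 1 ≤ n := by
          rw [Finsupp.single_le_iff]
          omega
        rw [if_pos hle, ih, if_neg (c := ∀ j ∈ insert k T, n j = 0), sub_eq_zero]
        · refine if_congr (forall₂_congr fun j hj => ?_) rfl rfl
          have : k ≠ j := fun h => hk (h ▸ hj)
          simp [this]
        · exact fun h => hn (h k (Finset.mem_insert_self _ _))
  ext n
  rw [h, MvPowerSeries.coeff_one]
  refine if_congr ?_ rfl rfl
  simp [Finsupp.ext_iff]

/-- The relatively free algebra of the algebra of `1 × 1` matrices is the polynomial algebra: words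
of the same multidegree have the same values, and they do not vanish at `1`. -/
theorem relFreeHilbert_matrix_one :
    relFreeHilbert K (Matrix (Fin 1) (Fin 1) K) d = polyHilbert K d := by
  ext n
  rw [polyHilbert_apply]
  change (finrank K (relFreeComponent K (Matrix (Fin 1) (Fin 1) K) d n) : ℤ) = 1
  obtain ⟨w, hw⟩ : ∃ w : List (Fin d), wordDegree w = n :=
    ⟨(Finsupp.toMultiset n).toList, by simp [wordDegree]⟩
  have hlift : ∀ (r : Fin d → Matrix (Fin 1) (Fin 1) K) (v : List (Fin d)),
      FreeAlgebra.lift K r (word K v) = (v.map r).prod := by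
    intro r v
    induction v with
    | nil => simp
    | cons i v ih => simp [ih]
  set π := (Ideal.Quotient.mkₐ K (tIdealIn K (Matrix (Fin 1) (Fin 1) K) d)).toLinearMap
  have hπ : ∀ f, π f = 0 ↔ f ∈ tIdealIn K (Matrix (Fin 1) (Fin 1) K) d :=
    fun f => Ideal.Quotient.eq_zero_iff_mem
  have himg : π '' (word K '' {v | wordDegree v = n}) = {π (word K w)} := by
    refine Set.eq_singleton_iff_unique_mem.2 ⟨⟨_, ⟨w, hw, rfl⟩, rfl⟩, ?_⟩
    rintro _ ⟨_, ⟨v, hv, rfl⟩, rfl⟩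
    rw [← sub_eq_zero, ← map_sub, hπ, mem_tIdealIn]
    intro r
    have hperm : v.Perm w :=
      Multiset.coe_eq_coe.1 (Multiset.toFinsupp.injective (hv.trans hw.symm))
    have hcomm : ∀ M N : Matrix (Fin 1) (Fin 1) K, Commute M N := fun M N => by
      ext i j
      simp [Matrix.mul_apply, Subsingleton.elim i 0, Subsingleton.elim j 0, mul_comm]
    rw [map_sub, sub_eq_zero, hlift, hlift]
    exact (hperm.map r).prod_eq' (List.pairwise_of_forall fun _ _ => hcomm _ _)
  have hne : π (word K w) ≠ 0 := by
    rw [Ne, hπ, mem_tIdealIn]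
    intro h
    have := h fun _ => 1
    rw [hlift] at this
    simp at this
  rw [relFreeComponent, freeComponent_eq_span, Submodule.map_span, himg,
    finrank_span_singleton hne, Nat.cast_one]

end Polynomial

/-- The closed form follows from `1 + D H = (1 + D a)ᵖ (1 + D b)^q` by expanding the powers and
cancelling `D`. -/
theorem eq_sum_choose_of_one_add_mul {A : Type*} [CommRing A] [NoZeroDivisors A] {D H a b : A}
    (hD : D ≠ 0) (p q : ℕ) (h : 1 + D * H = (1 + D * a) ^ p * (1 + D * b) ^ q) :
    H = (∑ i ∈ Finset.Icc 1 p, (p.choose i : A) * D ^ (i - 1) * a ^ i)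
      + (∑ j ∈ Finset.Icc 1 q, (q.choose j : A) * D ^ (j - 1) * b ^ j)
      + (∑ i ∈ Finset.Icc 1 p, ∑ j ∈ Finset.Icc 1 q,
        (p.choose i : A) * (q.choose j : A) * D ^ (i + j - 1) * a ^ i * b ^ j) := by
  have hpow : ∀ (x : A) (n : ℕ),
      (1 + D * x) ^ n = 1 + ∑ i ∈ Finset.Icc 1 n, (n.choose i : A) * D ^ i * x ^ i := by
    intro x n
    rw [add_comm 1 (D * x), add_pow, Finset.range_eq_Ico, Finset.sum_eq_sum_Ico_succ_bot (by omega)]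
    simp only [pow_zero, one_pow, mul_one, Nat.choose_zero_right, Nat.cast_one, zero_add]
    refine congrArg _ (Finset.sum_congr ?_ fun i _ => ?_)
    · ext i
      simp only [Finset.mem_Ico, Finset.mem_Icc]
      omega
    · rw [mul_pow]
      ring
  have h1 : ∀ (x : A) (n : ℕ), ∑ i ∈ Finset.Icc 1 n, (n.choose i : A) * D ^ i * x ^ i =
      D * ∑ i ∈ Finset.Icc 1 n, (n.choose i : A) * D ^ (i - 1) * x ^ i := by
    intro x n
    rw [Finset.mul_sum]
    refine Finset.sum_congr rfl fun i hi => ?_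
    obtain ⟨k, rfl⟩ := Nat.exists_eq_add_of_le (Finset.mem_Icc.1 hi).1
    rw [Nat.add_sub_cancel_left]
    ring
  have h2 : (∑ i ∈ Finset.Icc 1 p, (p.choose i : A) * D ^ i * a ^ i) *
      (∑ j ∈ Finset.Icc 1 q, (q.choose j : A) * D ^ j * b ^ j) =
      D * ∑ i ∈ Finset.Icc 1 p, ∑ j ∈ Finset.Icc 1 q,
        (p.choose i : A) * (q.choose j : A) * D ^ (i + j - 1) * a ^ i * b ^ j := by
    rw [Finset.sum_mul_sum, Finset.mul_sum]
    refine Finset.sum_congr rfl fun i hi => ?_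
    rw [Finset.mul_sum]
    refine Finset.sum_congr rfl fun j _ => ?_
    obtain ⟨k, rfl⟩ := Nat.exists_eq_add_of_le (Finset.mem_Icc.1 hi).1
    rw [show 1 + k + j - 1 = k + j by omega]
    ring
  refine mul_left_cancel₀ hD ?_
  rw [hpow, hpow] at h
  rw [mul_add, mul_add, ← h1, ← h1, ← h2]
  linear_combination h

end PIAlg

end

open PIAlg
theorem proposition1p5 (K : Type*) [Field K] [CharZero K] (d p q : ℕ)
    -- the sizes of the diagonal blocks, in any order: `p` of them are 1 and `q` of them are 2
    (s : Fin (p + q) → ℕ)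
    (hp : (Finset.univ.filter fun i => s i = 1).card = p)
    (hq : (Finset.univ.filter fun i => s i = 2).card = q) :
    relFreeHilbert K (UpperBlock K s) d =
        (∑ i ∈ Finset.Icc 1 p,
          (p.choose i : MvPowerSeries (Fin d) ℤ) * ((∑ k, MvPowerSeries.X k) - 1) ^ (i - 1)
            * polyHilbert K d ^ i)
        + (∑ j ∈ Finset.Icc 1 q,
          (q.choose j : MvPowerSeries (Fin d) ℤ) * ((∑ k, MvPowerSeries.X k) - 1) ^ (j - 1)
            * relFreeHilbert K (Matrix (Fin 2) (Fin 2) K) d ^ j)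
        + (∑ i ∈ Finset.Icc 1 p, ∑ j ∈ Finset.Icc 1 q,
          (p.choose i : MvPowerSeries (Fin d) ℤ) * (q.choose j : MvPowerSeries (Fin d) ℤ)
            * ((∑ k, MvPowerSeries.X k) - 1) ^ (i + j - 1)
            * polyHilbert K d ^ i * relFreeHilbert K (Matrix (Fin 2) (Fin 2) K) d ^ j)
      ∧ polyHilbert K d * ∏ k : Fin d, (1 - MvPowerSeries.X k) = 1 := by
  refine ⟨eq_sum_choose_of_one_add_mul ?_ p q ?_, polyHilbert_mul_prod K d⟩
  · -- the constant coefficient of `t₁ + ⋯ + t_d - 1` is `-1`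
    intro h
    simpa using congrArg MvPowerSeries.constantCoeff h
  · have hdisj : Disjoint (Finset.univ.filter fun i => s i = 1)
        (Finset.univ.filter fun i => s i = 2) :=
      Finset.disjoint_filter.2 fun i _ h1 h2 => by omega
    have hunion : (Finset.univ.filter fun i => s i = 1) ∪ (Finset.univ.filter fun i => s i = 2) =
        Finset.univ := by
      rw [← Finset.card_eq_iff_eq_univ, Finset.card_union_of_disjoint hdisj, hp, hq,
        Fintype.card_fin]
    rw [relFreeHilbert_upperBlock, ← hunion, Finset.prod_union hdisj,
      Finset.prod_eq_pow_card (b := 1 + ((∑ i, MvPowerSeries.X i) - 1) * polyHilbert K d),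
      Finset.prod_eq_pow_card (b := 1 + ((∑ i, MvPowerSeries.X i) - 1) *
        relFreeHilbert K (Matrix (Fin 2) (Fin 2) K) d), hp, hq]
    · intro i hi
      rw [(Finset.mem_filter.1 hi).2]
    · intro i hi
      rw [(Finset.mem_filter.1 hi).2, relFreeHilbert_matrix_one]
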